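/- All Hilbert and Banach spaces are real. A norm $|\cdot|$ on a separable Hilbert space $H$ is called measurable if for every $\epsilon>0$ there is a finite-dimensional subspace $F_\epsilon\subset H$ such that $\gamma_F\{h\in F:|h|>\epsilon\}<\epsilon$ for every finite-dimensional subspace $F\perp F_\epsilon$, where $\gamma_F$ is the standard Gaussian measure on $F$. A triple $(H,B,\mu)$ is an abstract Wiener space if $H$ is a separable Hilbert space with norm $\|\cdot\|$, $B$ is the completion of $H$ with respect to a measurable norm $|\cdot|$, and $\mu$ is a Borel probability measure on $B$ such that $\int_B e^{i\varphi}\,d\mu=e^{-\frac12\|f\|^2}$ whenever $f\in H$ and $\varphi\in B^*$ satisfy $\varphi(h)=\langle f,h\rangle$ for all $h\in H$. Proposition. Let $(H_1,B_1,\mu_1)$ and $(H_2,B_2,\mu_2)$ be abstract Wiener spaces with $H_1,H_2$ infinite-dimensional. Let $|\cdot|_1,|\cdot|_2$ be the norms of $B_1,B_2$. Let $H_1\oplus H_2$ be the Hilbert direct sum, with $\langle(h_1,h_2),(g_1,g_2)\rangle=\langle h_1,g_1\rangle_1+\langle h_2,g_2\rangle_2$, and let $B_1\oplus B_2$ be the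 space of pairs $(x_1,x_2)$ with norm $|(x_1,x_2)|=|x_1|_1+|x_2|_2$. Then $B_1\oplus B_2$ is a separable Banach space, and $(H_1\oplus H_2,\,B_1\oplus B_2,\,\mu_1\times\mu_2)$ is an abstract Wiener space, with the componentwise embedding $H_1\oplus H_2\subset B_1\oplus B_2$. Moreover, $H_1\oplus H_2$ is the Cameron–Martin space of $(B_1\oplus B_2,\mu_1\times\mu_2)$: it is exactly the set of $x\in B_1\oplus B_2$ for which $$\|x\|':=\sup\{\varphi(x):\varphi\in(B_1\oplus B_2)^*,\ \|\varphi\|_{L^2(\mu_1\times\mu_2)}\le 1\}$$ is finite, and $\|x\|'$ equals the Hilbert norm of $x$ for every $x\in H_1\oplus H_2$. -/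

import Mathlib

open MeasureTheory ProbabilityTheory
open scoped ENNReal

noncomputable section

/-- Standard Gaussian measure `γ_F` on a finite-dimensional subspace `F` of a real inner product
space, on the Borel σ-algebra of `F`. -/
def gammaMeasure {H : Type*} [NormedAddCommGroup H] [InnerProductSpace ℝ H]
    (F : Submodule ℝ H) [FiniteDimensional ℝ F] : @Measure F (borel F) :=
  letI : MeasurableSpace F := borel F
  stdGaussian F

/-- `N` is a measurable norm (in the sense of Gross) on the real inner product space `H`: it is a
norm, and for every `ε > 0` there is a finite-dimensional subspace `F₀` with
`γ_F {h ∈ F : N h > ε} < ε` for every finite-dimensional subspace `F` orthogonal to `F₀`. -/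
structure IsMeasurableNorm {H : Type*} [NormedAddCommGroup H] [InnerProductSpace ℝ H]
    (N : Seminorm ℝ H) : Prop where
  definite : ∀ h : H, N h = 0 → h = 0
  tight : ∀ ε : ℝ, 0 < ε → ∃ F₀ : Submodule ℝ H, FiniteDimensional ℝ F₀ ∧
    ∀ (F : Submodule ℝ H) [FiniteDimensional ℝ F], F.IsOrtho F₀ →
      gammaMeasure F {h : F | ε < N (h : H)} < ENNReal.ofReal ε

/-- `(H, B, μ)` is an abstract Wiener space, where `ι : H → B` is the canonical map of `H` into
its completion `B`. That `B` is the completion of `H` for the norm `h ↦ ‖ι h‖` is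
expressed by completeness of `B` and density of the range of `ι`.

The last field says that the functional `φ = I(f)` on `B` which agrees with `⟪f, ·⟫` on `H` is,
under `μ`, a centered Gaussian variable with variance `‖f‖²`, for all `f` such that `⟪f, ·⟫` extends
continuously to `B`. -/
structure IsAbstractWienerSpace {H B : Type*} [NormedAddCommGroup H] [InnerProductSpace ℝ H]
    [NormedAddCommGroup B] [NormedSpace ℝ B] [MeasurableSpace B]
    (ι : H →ₗ[ℝ] B) (μ : Measure B) : Prop where
  complete_H : CompleteSpace H
  separable_H : TopologicalSpace.SeparableSpace H
  measurable_norm : IsMeasurableNorm ((normSeminorm ℝ B).comp ι)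
  complete_B : CompleteSpace B
  dense : DenseRange ι
  borel_B : BorelSpace B
  prob : IsProbabilityMeasure μ
  gaussian : ∀ (f : H) (φ : StrongDual ℝ B), (∀ h : H, φ (ι h) = inner ℝ f h) →
    ∫ x, Complex.exp (Complex.I * (φ x : ℂ)) ∂μ = Complex.exp (-(1 / 2 : ℂ) * (‖f‖ : ℂ) ^ 2)

/-- The Cameron–Martin norm of `x ∈ B`: the supremum of `φ x` over the continuous linear
functionals `φ` on `B` with `‖φ‖_{L²(μ)} ≤ 1`, with value `∞` allowed. (The supremum is
nonnegative since `φ = 0` is admitted.) -/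
def cameronMartinNorm {B : Type*} [NormedAddCommGroup B] [NormedSpace ℝ B] [MeasurableSpace B]
    (μ : Measure B) (x : B) : ℝ≥0∞ :=
  ⨆ (φ : StrongDual ℝ B) (_ : eLpNorm φ 2 μ ≤ 1), ENNReal.ofReal (φ x)

/-- The Hilbert space `H`, embedded in `B` by `ι`, is the Cameron–Martin space of `(B, μ)`, with
the same norm. -/
def IsCameronMartinSpace {H B : Type*} [NormedAddCommGroup H] [InnerProductSpace ℝ H]
    [NormedAddCommGroup B] [NormedSpace ℝ B] [MeasurableSpace B]
    (ι : H →ₗ[ℝ] B) (μ : Measure B) : Prop :=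
  Function.Injective ι ∧ Set.range ι = {x : B | cameronMartinNorm μ x < ∞} ∧
    ∀ h : H, cameronMartinNorm μ (ι h) = ENNReal.ofReal ‖h‖

/-- The map `(h₁, h₂) ↦ (ι₁ h₁, ι₂ h₂)` from the Hilbert direct sum `H₁ ⊕ H₂`, with inner product
`⟪h₁, g₁⟫ + ⟪h₂, g₂⟫`, to `B₁ ⊕ B₂` with norm `‖x₁‖ + ‖x₂‖`. -/
def directSumMap {H₁ H₂ B₁ B₂ : Type*}
    [NormedAddCommGroup H₁] [InnerProductSpace ℝ H₁] [NormedAddCommGroup H₂]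
    [InnerProductSpace ℝ H₂] [NormedAddCommGroup B₁] [NormedSpace ℝ B₁]
    [NormedAddCommGroup B₂] [NormedSpace ℝ B₂]
    (ι₁ : H₁ →ₗ[ℝ] B₁) (ι₂ : H₂ →ₗ[ℝ] B₂) :
    WithLp 2 (H₁ × H₂) →ₗ[ℝ] WithLp 1 (B₁ × B₂) where
  toFun h := WithLp.toLp 1 (ι₁ h.fst, ι₂ h.snd)
  map_add' h g := (WithLp.ofLp_injective 1) (by ext <;> simp)
  map_smul' c h := (WithLp.ofLp_injective 1) (by ext <;> simp)

/-- The product measure `μ₁ × μ₂`, as a measure on the normed space `B₁ ⊕ B₂`. -/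
def directSumMeasure {B₁ B₂ : Type*} [MeasurableSpace B₁] [MeasurableSpace B₂]
    (μ₁ : Measure B₁) (μ₂ : Measure B₂) : Measure (WithLp 1 (B₁ × B₂)) :=
  (μ₁.prod μ₂).map (WithLp.toLp 1)

end

/-! The delicate point is tightness. A finite-dimensional `F` orthogonal to `F₁ ⊕ F₂` need not split
as a direct sum, but its coordinate projections `Eᵢ` are orthogonal to `Fᵢ`. The image of `γ_F` in
`Eᵢ` is a centered Gaussian with covariance at most the identity, so convolving it with another
centered Gaussian gives `γ_{Eᵢ}`. Symmetric noise at most halves the tails of a seminorm, so `γ_F`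
tails cost a factor 2 over `γ_{Eᵢ}` (`stdGaussian_lt_norm_comp_le`). The Gaussian property follows
from Fubini.

The Cameron–Martin claim holds for every abstract Wiener space: a measurable norm is continuous, so
functionals on `B` restrict to `H`. Their Riesz representatives are dense, and their norms are the
`L²(μ)` norms, so the supremum is the Hilbert norm by duality. -/

/-! ### Domination of Gaussian tails under projection. -/

section GaussianDomination

variable {E : Type*} [NormedAddCommGroup E] [InnerProductSpace ℝ E] [FiniteDimensional ℝ E]
  [MeasurableSpace E] [BorelSpace E]

/-- Adding an independent symmetric random vector at most halves tail probabilities of a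
seminorm. -/
theorem measure_lt_norm_le_two_mul_conv {B : Type*} [NormedAddCommGroup B] [NormedSpace ℝ B]
    (T : E →ₗ[ℝ] B) (μ ν : Measure E) [IsProbabilityMeasure μ] [IsProbabilityMeasure ν]
    (hν : ν.map (fun x ↦ -x) = ν) (a : ℝ) :
    μ {x | a < ‖T x‖} ≤ 2 * (μ ∗ ν) {x | a < ‖T x‖} := by
  have hT : Continuous T := T.continuous_of_finiteDimensional
  have hs : MeasurableSet {x | a < ‖T x‖} :=
    (isOpen_lt continuous_const hT.norm).measurableSet
  have hfst : μ {x | a < ‖T x‖} = (μ.prod ν) {p | a < ‖T p.1‖} := by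
    have : {p : E × E | a < ‖T p.1‖} = {x | a < ‖T x‖} ×ˢ Set.univ := by ext; simp
    rw [this, Measure.prod_prod, measure_univ, mul_one]
  have hadd : (μ.prod ν) {p | a < ‖T (p.1 + p.2)‖} = (μ ∗ ν) {x | a < ‖T x‖} := by
    rw [Measure.conv, Measure.map_apply measurable_add hs]
    rfl
  have hsub : (μ.prod ν) {p | a < ‖T (p.1 - p.2)‖} = (μ ∗ ν) {x | a < ‖T x‖} := by
    rw [← hadd]
    have hmap : (μ.prod ν).map (Prod.map id (fun x ↦ -x)) = μ.prod ν := by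
      rw [← Measure.map_prod_map _ _ measurable_id measurable_neg, hν, Measure.map_id]
    nth_rewrite 2 [← hmap]
    have hs' : MeasurableSet {p : E × E | a < ‖T (p.1 + p.2)‖} := measurable_add hs
    rw [Measure.map_apply (f := Prod.map id (fun x : E ↦ -x))
      (measurable_id.prodMap measurable_neg) hs']
    simp [sub_eq_add_neg]
  -- `2x = (x + y) + (x - y)`, so one of the two summands has seminorm above `a`; by symmetry of `ν`
  -- both have the same law.
  have hsubset : {p : E × E | a < ‖T p.1‖} ⊆
      {p | a < ‖T (p.1 + p.2)‖} ∪ {p | a < ‖T (p.1 - p.2)‖} := by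
    intro p hp
    by_contra hcon
    simp only [Set.mem_union, Set.mem_ofPred_eq, not_or, not_lt] at hcon hp
    have h2 : (2 : ℝ) • T p.1 = T (p.1 + p.2) + T (p.1 - p.2) := by
      rw [← map_add, ← map_smul]
      congr 1
      module
    have h3 := norm_add_le (T (p.1 + p.2)) (T (p.1 - p.2))
    rw [← h2, norm_smul, Real.norm_ofNat] at h3
    linarith
  calc μ {x | a < ‖T x‖} = (μ.prod ν) {p | a < ‖T p.1‖} := hfst
    _ ≤ (μ.prod ν) {p | a < ‖T (p.1 + p.2)‖} + (μ.prod ν) {p | a < ‖T (p.1 - p.2)‖} :=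
      (measure_mono hsubset).trans (measure_union_le _ _)
    _ = 2 * (μ ∗ ν) {x | a < ‖T x‖} := by rw [hadd, hsub, two_mul]

variable {F W : Type*} [NormedAddCommGroup F] [InnerProductSpace ℝ F] [FiniteDimensional ℝ F]
  [MeasurableSpace F] [BorelSpace F]
  [NormedAddCommGroup W] [InnerProductSpace ℝ W] [FiniteDimensional ℝ W]

theorem charFun_stdGaussian_map (L : F →ₗ[ℝ] E) (t : E) :
    charFun ((stdGaussian F).map L) t = Complex.exp (-(‖L.adjoint t‖ : ℂ) ^ 2 / 2) := by
  have hL : Measurable L := L.continuous_of_finiteDimensional.measurable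
  rw [← charFun_stdGaussian, charFun_apply, charFun_apply, integral_map hL.aemeasurable
    (by fun_prop)]
  simp_rw [LinearMap.adjoint_inner_right]

/-- The standard Gaussian measure of a subspace `F` of `W`, projected onto another subspace `E`,
has its tail probabilities dominated by those of the standard Gaussian measure of `E`. -/
theorem stdGaussian_lt_norm_comp_le {B : Type*} [NormedAddCommGroup B] [NormedSpace ℝ B]
    (T : E →ₗ[ℝ] B) (j : F →ₗᵢ[ℝ] W) (Q : E →ₗᵢ[ℝ] W) (a : ℝ) :
    stdGaussian F {h | a < ‖T (Q.toLinearMap.adjoint (j h))‖} ≤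
      2 * stdGaussian E {x | a < ‖T x‖} := by
  let _ : MeasurableSpace W := borel W
  have : BorelSpace W := ⟨rfl⟩
  let L : F →ₗ[ℝ] E := Q.toLinearMap.adjoint ∘ₗ j.toLinearMap
  -- The complementary noise: compressing the projection onto `(j F)ᗮ` to `E` gives `M M* = 1 - L
  -- L*`.
  let M : W →ₗ[ℝ] E :=
    Q.toLinearMap.adjoint ∘ₗ (LinearMap.id - j.toLinearMap ∘ₗ j.toLinearMap.adjoint)
  have hL : Measurable L := L.continuous_of_finiteDimensional.measurable
  have hM : Measurable M := M.continuous_of_finiteDimensional.measurable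
  have : IsProbabilityMeasure ((stdGaussian F).map L) :=
    Measure.isProbabilityMeasure_map hL.aemeasurable
  have : IsProbabilityMeasure ((stdGaussian W).map M) :=
    Measure.isProbabilityMeasure_map hM.aemeasurable
  have hsymm : ((stdGaussian W).map M).map (fun x ↦ -x) = (stdGaussian W).map M := by
    have : IsProbabilityMeasure (((stdGaussian W).map M).map (fun x ↦ -x)) :=
      Measure.isProbabilityMeasure_map measurable_neg.aemeasurable
    refine Measure.ext_of_charFun (funext fun t ↦ ?_)
    have h1 : ((stdGaussian W).map M).map (fun x ↦ -x) = (stdGaussian W).map (-M) := by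
      rw [Measure.map_map measurable_neg hM]
      rfl
    rw [h1, charFun_stdGaussian_map, charFun_stdGaussian_map]
    simp
  have hdecomp (t : E) : ‖L.adjoint t‖ ^ 2 + ‖M.adjoint t‖ ^ 2 = ‖t‖ ^ 2 := by
    have hLt : L.adjoint t = j.toLinearMap.adjoint (Q t) := by simp [L, LinearMap.adjoint_comp]
    have hMt : M.adjoint t = Q t - j (j.toLinearMap.adjoint (Q t)) := by
      simp [M, LinearMap.adjoint_comp]
    have hinner : inner ℝ (Q t) (j (j.toLinearMap.adjoint (Q t))) =
        ‖j.toLinearMap.adjoint (Q t)‖ ^ 2 := by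
      rw [← real_inner_self_eq_norm_sq]
      exact (LinearMap.adjoint_inner_left j.toLinearMap _ _).symm
    rw [hLt, hMt, norm_sub_sq_real, hinner, j.norm_map, Q.norm_map]
    ring
  have hconv : (stdGaussian F).map L ∗ (stdGaussian W).map M = stdGaussian E := by
    refine Measure.ext_of_charFun (funext fun t ↦ ?_)
    rw [charFun_conv, charFun_stdGaussian_map, charFun_stdGaussian_map, charFun_stdGaussian,
      ← Complex.exp_add]
    congr 1
    have := congrArg (fun r : ℝ ↦ (r : ℂ)) (hdecomp t)
    push_cast at this
    rw [← this]
    ring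
  have key := measure_lt_norm_le_two_mul_conv T ((stdGaussian F).map L) ((stdGaussian W).map M)
    hsymm a
  rw [hconv, Measure.map_apply hL
    (isOpen_lt continuous_const T.continuous_of_finiteDimensional.norm).measurableSet] at key
  exact key

end GaussianDomination

/-! ### Continuity of measurable norms and the Cameron–Martin space. -/

theorem eLpNorm_two_id_gaussianReal (v : NNReal) :
    eLpNorm id 2 (gaussianReal 0 v) = ENNReal.ofReal (√v) := by
  have hvar : ∫ x, x ^ 2 ∂(gaussianReal 0 v) = v := by
    have := variance_of_integral_eq_zero (μ := gaussianReal 0 v) (X := id) aemeasurable_id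
      (by simp)
    simpa using this.symm
  rw [(memLp_id_gaussianReal' 2 (by simp)).eLpNorm_eq_integral_rpow_norm (by simp) (by simp)]
  simp [hvar, Real.sqrt_eq_rpow]

section CameronMartin

variable {H B : Type*} [NormedAddCommGroup H] [InnerProductSpace ℝ H]
  [NormedAddCommGroup B] [NormedSpace ℝ B]

/-- A measurable norm is continuous. -/
theorem IsMeasurableNorm.continuous {ι : H →ₗ[ℝ] B}
    (hN : IsMeasurableNorm ((normSeminorm ℝ B).comp ι)) : Continuous ι := by
  -- With this `ε`, the line through a unit vector `u ⊥ F₀` with `‖ι u‖ > 1` would violate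
  -- tightness.
  obtain ⟨ε, hε, hprob⟩ : ∃ ε : ℝ, 0 < ε ∧
      ENNReal.ofReal ε ≤ gaussianReal 0 1 {x : ℝ | ε < ‖x‖} := by
    have hpos : gaussianReal 0 1 {x : ℝ | 1 < ‖x‖} ≠ 0 := by
      intro h0
      have hvol := gaussianReal_absolutelyContinuous' 0 one_ne_zero h0
      exact ((isOpen_lt continuous_const continuous_norm).measure_pos volume
        ⟨2, by norm_num⟩).ne' hvol
    refine ⟨min 1 (gaussianReal 0 1 {x : ℝ | 1 < ‖x‖}).toReal,
      lt_min one_pos (ENNReal.toReal_pos hpos (measure_ne_top _ _)), ?_⟩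
    calc ENNReal.ofReal (min 1 (gaussianReal 0 1 {x : ℝ | 1 < ‖x‖}).toReal)
        ≤ ENNReal.ofReal (gaussianReal 0 1 {x : ℝ | 1 < ‖x‖}).toReal :=
          ENNReal.ofReal_le_ofReal (min_le_right _ _)
      _ = gaussianReal 0 1 {x : ℝ | 1 < ‖x‖} := ENNReal.ofReal_toReal (measure_ne_top _ _)
      _ ≤ _ := measure_mono fun x (hx : 1 < ‖x‖) ↦ (min_le_left _ _).trans_lt hx
  obtain ⟨F₀, hF₀, htight⟩ := hN.tight ε hε
  have hunit (u : H) (hu : ‖u‖ = 1) (horth : u ∈ F₀ᗮ) : ‖ι u‖ ≤ 1 := by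
    by_contra! hlt
    let F : Submodule ℝ H := Submodule.span ℝ {u}
    have hF : F.IsOrtho F₀ := by
      rw [Submodule.isOrtho_iff_le, Submodule.span_singleton_le_iff_mem]
      exact horth
    have hlow := htight F hF
    let _ : MeasurableSpace F := borel F
    have : BorelSpace F := ⟨rfl⟩
    let u' : F := ⟨u, Submodule.mem_span_singleton_self u⟩
    have hlaw : (stdGaussian F).map (innerₛₗ ℝ u') = gaussianReal 0 1 := by
      have hmeas : Measurable (innerₛₗ ℝ u') :=
        (innerₛₗ ℝ u').continuous_of_finiteDimensional.measurable
      have : IsProbabilityMeasure ((stdGaussian F).map (innerₛₗ ℝ u')) :=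
        Measure.isProbabilityMeasure_map hmeas.aemeasurable
      refine Measure.ext_of_charFun (funext fun t ↦ ?_)
      have hadj : (innerₛₗ ℝ u').adjoint t = t • u' := by
        refine ext_inner_right ℝ fun x ↦ ?_
        rw [LinearMap.adjoint_inner_left]
        simp [inner_smul_left, mul_comm]
      rw [charFun_stdGaussian_map, charFun_gaussianReal, hadj, norm_smul]
      have : ‖u'‖ = 1 := hu
      rw [this]
      congr 1
      simp only [Real.norm_eq_abs, mul_one, ← Complex.ofReal_pow, sq_abs]
      push_cast
      simp
      ring
    refine absurd (hprob.trans ?_) hlow.not_ge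
    rw [← hlaw, Measure.map_apply
      (innerₛₗ ℝ u').continuous_of_finiteDimensional.measurable
      (isOpen_lt continuous_const continuous_norm).measurableSet]
    refine measure_mono fun h hh ↦ ?_
    obtain ⟨c, hc⟩ := Submodule.mem_span_singleton.1 h.2
    have hin : inner ℝ u' h = c := by
      rw [Submodule.coe_inner, ← hc, inner_smul_right, real_inner_self_eq_norm_sq, hu]
      simp
    have hh' : ε < ‖c‖ := by
      rw [← hin]
      exact hh
    change ε < ‖ι h‖
    rw [← hc, map_smul, norm_smul]
    nlinarith [norm_nonneg c]
  have horth (h : H) (hh : h ∈ F₀ᗮ) : ‖ι h‖ ≤ ‖h‖ := by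
    rcases eq_or_ne h 0 with rfl | hne
    · simp
    · have := hunit ((‖h‖⁻¹ : ℝ) • h) (norm_smul_inv_norm (𝕜 := ℝ) hne)
        (F₀ᗮ.smul_mem _ hh)
      rw [map_smul, norm_smul, norm_inv, norm_norm, inv_mul_le_iff₀ (norm_pos_iff.2 hne)] at this
      simpa using this
  let T : F₀ →L[ℝ] B := (ι ∘ₗ F₀.subtype).toContinuousLinearMap
  refine AddMonoidHomClass.continuous_of_bound ι (‖T‖ + 2) fun h ↦ ?_
  have hsplit : ι h = T (F₀.orthogonalProjectionOnto h) +
      ι (h - F₀.orthogonalProjectionOnto h) := by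
    simp [T]
  calc ‖ι h‖ ≤ ‖T (F₀.orthogonalProjectionOnto h)‖ + ‖ι (h - F₀.orthogonalProjectionOnto h)‖ := by
        rw [hsplit]
        exact norm_add_le _ _
    _ ≤ ‖T‖ * ‖h‖ + 2 * ‖h‖ := by
        gcongr
        · exact (T.le_opNorm _).trans
            (by gcongr; exact F₀.norm_orthogonalProjectionOnto_apply_le h)
        · refine (horth _ (F₀.sub_starProjection_mem_orthogonal h)).trans ((norm_sub_le _ _).trans ?_)
          rw [two_mul]
          gcongr
          exact F₀.norm_orthogonalProjectionOnto_apply_le h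
    _ = (‖T‖ + 2) * ‖h‖ := by ring

variable [MeasurableSpace B] {ι : H →ₗ[ℝ] B} {μ : Measure B}

theorem IsAbstractWienerSpace.injective (hW : IsAbstractWienerSpace ι μ) :
    Function.Injective ι :=
  (injective_iff_map_eq_zero ι).2 fun h hh ↦ hW.measurable_norm.definite h (by simp [hh])

/-- A functional extending `⟪f, ·⟫` has `L²`-norm `‖f‖`. -/
theorem IsAbstractWienerSpace.eLpNorm_dual (hW : IsAbstractWienerSpace ι μ) (f : H)
    (φ : StrongDual ℝ B) (hφ : ∀ h, φ (ι h) = inner ℝ f h) :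
    eLpNorm φ 2 μ = ENNReal.ofReal ‖f‖ := by
  have := hW.borel_B
  have := hW.prob
  have hmeas : Measurable φ := φ.continuous.measurable
  have : IsProbabilityMeasure (μ.map φ) := Measure.isProbabilityMeasure_map hmeas.aemeasurable
  have hlaw : μ.map φ = gaussianReal 0 (‖f‖₊ ^ 2) := by
    refine Measure.ext_of_charFun (funext fun t ↦ ?_)
    rw [charFun_apply_real, integral_map hmeas.aemeasurable (by fun_prop), charFun_gaussianReal]
    -- The Gaussian hypothesis is the characteristic function at 1; scaling gives it at every `t`.
    have h := hW.gaussian (t • f) (t • φ) fun h ↦ by simp [hφ, inner_smul_left]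
    simp only [smul_apply, smul_eq_mul, norm_smul] at h
    have h2 : (((‖t‖ * ‖f‖ : ℝ) : ℂ)) ^ 2 = (t : ℂ) ^ 2 * (‖f‖ : ℂ) ^ 2 := by
      rw [← Complex.ofReal_pow, mul_pow, Real.norm_eq_abs, sq_abs]
      push_cast
      rfl
    rw [h2] at h
    convert h using 2
    · ext x
      congr 1
      push_cast
      ring
    · push_cast
      simp
      ring
  have h := eLpNorm_two_id_gaussianReal (‖f‖₊ ^ 2)
  rw [← hlaw, eLpNorm_map_measure aestronglyMeasurable_id hmeas.aemeasurable] at h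
  simpa using h

/-- The Hilbert space of an abstract Wiener space is its Cameron–Martin space. -/
theorem IsAbstractWienerSpace.isCameronMartinSpace (hW : IsAbstractWienerSpace ι μ) :
    IsCameronMartinSpace ι μ := by
  have := hW.complete_H
  let ιc : H →L[ℝ] B := ⟨ι, hW.measurable_norm.continuous⟩
  -- The Riesz representative of the restriction to `H`.
  let R : StrongDual ℝ B →ₗ[ℝ] H :=
    { toFun φ := (InnerProductSpace.toDual ℝ H).symm (φ ∘L ιc)
      map_add' φ ψ := by simp [ContinuousLinearMap.add_comp]
      map_smul' c φ := by simp [ContinuousLinearMap.smul_comp] }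
  have hR (φ : StrongDual ℝ B) (h : H) : φ (ι h) = inner ℝ (R φ) h := by
    simp [R, ιc]
  have hnorm (φ : StrongDual ℝ B) : eLpNorm φ 2 μ ≤ 1 ↔ ‖R φ‖ ≤ 1 := by
    rw [hW.eLpNorm_dual (R φ) φ (hR φ), ENNReal.ofReal_le_one]
  have hdense : DenseRange R := by
    change Dense (LinearMap.range R : Set H)
    rw [Submodule.dense_iff_topologicalClosure_eq_top, Submodule.topologicalClosure_eq_top_iff,
      Submodule.eq_bot_iff]
    intro h hh
    refine hW.measurable_norm.definite h ?_
    have : ι h = 0 := by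
      refine SeparatingDual.eq_zero_of_forall_dual_eq_zero (R := ℝ) fun φ ↦ ?_
      rw [hR]
      exact (Submodule.mem_orthogonal _ _).1 hh _ (LinearMap.mem_range_self R φ)
    simp [this]
  have hval (h : H) : cameronMartinNorm μ (ι h) = ENNReal.ofReal ‖h‖ := by
    refine le_antisymm ?_ ?_
    · refine iSup₂_le fun φ hφ ↦ ENNReal.ofReal_le_ofReal ?_
      rw [hR]
      exact (real_inner_le_norm _ _).trans
        (mul_le_of_le_one_left (norm_nonneg h) ((hnorm φ).1 hφ))
    · set C := cameronMartinNorm μ (ι h) with hC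
      rcases eq_or_ne C ∞ with htop | htop
      · simp [htop]
      have hbound (φ : StrongDual ℝ B) (hφ : ‖R φ‖ ≤ 1) : inner ℝ (R φ) h ≤ C.toReal := by
        rw [← hR]
        refine (ENNReal.ofReal_le_iff_le_toReal htop).1 ?_
        exact le_iSup₂_of_le (f := fun (φ : StrongDual ℝ B) (_ : eLpNorm φ 2 μ ≤ 1) ↦
          ENNReal.ofReal (φ (ι h))) φ ((hnorm φ).2 hφ) le_rfl
      have hbound' (φ : StrongDual ℝ B) : inner ℝ (R φ) h ≤ C.toReal * ‖R φ‖ := by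
        rcases eq_or_ne (R φ) 0 with h0 | h0
        · simp [h0]
        have := hbound ((‖R φ‖⁻¹ : ℝ) • φ)
          (by rw [map_smul]; exact (norm_smul_inv_norm (𝕜 := ℝ) h0).le)
        rw [map_smul, real_inner_smul_left, inv_mul_le_iff₀ (norm_pos_iff.2 h0)] at this
        linarith
      have hall : inner ℝ h h ≤ C.toReal * ‖h‖ :=
        hdense.induction (P := fun g ↦ inner ℝ g h ≤ C.toReal * ‖g‖)
          (by rintro _ ⟨φ, rfl⟩; exact hbound' φ)
          (isClosed_le (by fun_prop) (by fun_prop)) h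
      refine ENNReal.ofReal_le_of_le_toReal ?_
      rw [real_inner_self_eq_norm_mul_norm] at hall
      rcases eq_or_ne h 0 with rfl | hne
      · simp
      · exact le_of_mul_le_mul_right hall (norm_pos_iff.2 hne)
  refine ⟨hW.injective, Set.Subset.antisymm ?_ fun x hx ↦ ?_, hval⟩
  · rintro _ ⟨h, rfl⟩
    simp [hval]
  · have htop : cameronMartinNorm μ x ≠ ∞ := ne_of_lt hx
    set C := cameronMartinNorm μ x
    have hbound (φ : StrongDual ℝ B) (hφ : ‖R φ‖ ≤ 1) : φ x ≤ C.toReal := by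
      refine (ENNReal.ofReal_le_iff_le_toReal htop).1 ?_
      exact le_iSup₂_of_le (f := fun (φ : StrongDual ℝ B) (_ : eLpNorm φ 2 μ ≤ 1) ↦
        ENNReal.ofReal (φ x)) φ ((hnorm φ).2 hφ) le_rfl
    have hle (φ : StrongDual ℝ B) : φ x ≤ C.toReal * ‖R φ‖ := by
      rcases eq_or_ne (R φ) 0 with h0 | h0
      -- Density of `H` in `B` makes `R` injective.
      · have : φ = 0 := by
          refine ContinuousLinearMap.ext fun y ↦ ?_
          exact hW.dense.induction (P := fun y ↦ φ y = 0)
            (by rintro _ ⟨h, rfl⟩; simp [hR, h0]) (isClosed_eq (by fun_prop) (by fun_prop)) y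
        simp [this]
      have := hbound ((‖R φ‖⁻¹ : ℝ) • φ)
          (by rw [map_smul]; exact (norm_smul_inv_norm (𝕜 := ℝ) h0).le)
      rw [smul_apply, smul_eq_mul, inv_mul_le_iff₀ (norm_pos_iff.2 h0)] at this
      linarith
    let ev : StrongDual ℝ B →ₗ[ℝ] ℝ := (NormedSpace.inclusionInDoubleDual ℝ B x).toLinearMap
    have hev : ∀ φ, ‖ev φ‖ ≤ C.toReal * ‖R φ‖ := fun φ ↦ by
      rw [Real.norm_eq_abs, abs_le']
      exact ⟨hle φ, by simpa [ev] using hle (-φ)⟩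
    -- Evaluation at `x` is bounded in terms of `‖R φ‖`, hence extends to a functional on `H`; its
    -- Riesz vector is the preimage of `x`, because functionals separate points.
    let h : H := (InnerProductSpace.toDual ℝ H).symm (ev.extendOfNorm R)
    refine ⟨h, ?_⟩
    refine sub_eq_zero.1 (SeparatingDual.eq_zero_of_forall_dual_eq_zero (R := ℝ) fun φ ↦ ?_)
    rw [map_sub, hR, real_inner_comm, InnerProductSpace.toDual_symm_apply,
      LinearMap.extendOfNorm_eq hdense ⟨_, hev⟩]
    simp [ev]

end CameronMartin

/-! ### The direct sum of two abstract Wiener spaces. -/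

section DirectSum

variable {H₁ H₂ B₁ B₂ : Type*}
  [NormedAddCommGroup H₁] [InnerProductSpace ℝ H₁]
  [NormedAddCommGroup H₂] [InnerProductSpace ℝ H₂]
  [NormedAddCommGroup B₁] [NormedSpace ℝ B₁]
  [NormedAddCommGroup B₂] [NormedSpace ℝ B₂]

/-- The inclusion of a subspace of `H₁ ⊕ H₂` into the direct sum of its two projections. -/
noncomputable def Submodule.inclusionProdMap (F : Submodule ℝ (WithLp 2 (H₁ × H₂))) :
    F →ₗᵢ[ℝ] WithLp 2 (F.map (WithLp.fstₗ 2 ℝ H₁ H₂) × F.map (WithLp.sndₗ 2 ℝ H₁ H₂)) where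
  toFun h := WithLp.toLp 2 (⟨(h : WithLp 2 (H₁ × H₂)).fst, Submodule.mem_map_of_mem h.2⟩,
    ⟨(h : WithLp 2 (H₁ × H₂)).snd, Submodule.mem_map_of_mem h.2⟩)
  map_add' _ _ := rfl
  map_smul' _ _ := rfl
  norm_map' h := by
    rw [← sq_eq_sq₀ (norm_nonneg _) (norm_nonneg _)]
    exact (WithLp.prod_norm_sq_eq_of_L2 _).trans
      (WithLp.prod_norm_sq_eq_of_L2 (h : WithLp 2 (H₁ × H₂))).symm

/-- `F` embeds isometrically in `E₁ ⊕ E₂`, and the first coordinate is the adjoint of the inclusion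
of `E₁`, so Gaussian domination applies. -/
theorem gammaMeasure_lt_norm_fst_le (ι : H₁ →ₗ[ℝ] B₁)
    (F : Submodule ℝ (WithLp 2 (H₁ × H₂))) [FiniteDimensional ℝ F] (a : ℝ) :
    gammaMeasure F {h | a < ‖ι (h : WithLp 2 (H₁ × H₂)).fst‖} ≤
      2 * gammaMeasure (F.map (WithLp.fstₗ 2 ℝ H₁ H₂)) {h | a < ‖ι h‖} := by
  let E₁ := F.map (WithLp.fstₗ 2 ℝ H₁ H₂)
  let E₂ := F.map (WithLp.sndₗ 2 ℝ H₁ H₂)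
  let _ : MeasurableSpace F := borel F
  have : BorelSpace F := ⟨rfl⟩
  let _ : MeasurableSpace E₁ := borel E₁
  have : BorelSpace E₁ := ⟨rfl⟩
  let Q : E₁ →ₗᵢ[ℝ] WithLp 2 (E₁ × E₂) :=
    { toFun h := WithLp.toLp 2 (h, 0)
      map_add' _ _ := WithLp.ofLp_injective 2 (by ext <;> simp)
      map_smul' _ _ := WithLp.ofLp_injective 2 (by ext <;> simp)
      norm_map' h := by simp }
  have hQ (w : WithLp 2 (E₁ × E₂)) : Q.toLinearMap.adjoint w = w.fst := by
    refine ext_inner_right ℝ fun x ↦ ?_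
    rw [LinearMap.adjoint_inner_left]
    simp [Q]
  have key := stdGaussian_lt_norm_comp_le (ι ∘ₗ E₁.subtype) F.inclusionProdMap Q a
  simp_rw [hQ] at key
  exact key

theorem gammaMeasure_lt_norm_snd_le (ι : H₂ →ₗ[ℝ] B₂)
    (F : Submodule ℝ (WithLp 2 (H₁ × H₂))) [FiniteDimensional ℝ F] (a : ℝ) :
    gammaMeasure F {h | a < ‖ι (h : WithLp 2 (H₁ × H₂)).snd‖} ≤
      2 * gammaMeasure (F.map (WithLp.sndₗ 2 ℝ H₁ H₂)) {h | a < ‖ι h‖} := by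
  let E₁ := F.map (WithLp.fstₗ 2 ℝ H₁ H₂)
  let E₂ := F.map (WithLp.sndₗ 2 ℝ H₁ H₂)
  let _ : MeasurableSpace F := borel F
  have : BorelSpace F := ⟨rfl⟩
  let _ : MeasurableSpace E₂ := borel E₂
  have : BorelSpace E₂ := ⟨rfl⟩
  let Q : E₂ →ₗᵢ[ℝ] WithLp 2 (E₁ × E₂) :=
    { toFun h := WithLp.toLp 2 (0, h)
      map_add' _ _ := WithLp.ofLp_injective 2 (by ext <;> simp)
      map_smul' _ _ := WithLp.ofLp_injective 2 (by ext <;> simp)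
      norm_map' h := by simp }
  have hQ (w : WithLp 2 (E₁ × E₂)) : Q.toLinearMap.adjoint w = w.snd := by
    refine ext_inner_right ℝ fun x ↦ ?_
    rw [LinearMap.adjoint_inner_left]
    simp [Q]
  have key := stdGaussian_lt_norm_comp_le (ι ∘ₗ E₂.subtype) F.inclusionProdMap Q a
  simp_rw [hQ] at key
  exact key

theorem norm_directSumMap (ι₁ : H₁ →ₗ[ℝ] B₁) (ι₂ : H₂ →ₗ[ℝ] B₂) (h : WithLp 2 (H₁ × H₂)) :
    ‖directSumMap ι₁ ι₂ h‖ = ‖ι₁ h.fst‖ + ‖ι₂ h.snd‖ :=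
  WithLp.prod_norm_eq_of_L1 _

theorem IsMeasurableNorm.directSum {ι₁ : H₁ →ₗ[ℝ] B₁} {ι₂ : H₂ →ₗ[ℝ] B₂}
    (h₁ : IsMeasurableNorm ((normSeminorm ℝ B₁).comp ι₁))
    (h₂ : IsMeasurableNorm ((normSeminorm ℝ B₂).comp ι₂)) :
    IsMeasurableNorm ((normSeminorm ℝ (WithLp 1 (B₁ × B₂))).comp (directSumMap ι₁ ι₂)) := by
  refine ⟨fun h hh ↦ ?_, fun ε hε ↦ ?_⟩
  · have hsum : ‖ι₁ h.fst‖ + ‖ι₂ h.snd‖ = 0 := by rw [← norm_directSumMap]; exact hh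
    have hfst := h₁.definite h.fst (le_antisymm
      (by change ‖ι₁ h.fst‖ ≤ 0; linarith [norm_nonneg (ι₂ h.snd)]) (norm_nonneg _))
    have hsnd := h₂.definite h.snd (le_antisymm
      (by change ‖ι₂ h.snd‖ ≤ 0; linarith [norm_nonneg (ι₁ h.fst)]) (norm_nonneg _))
    exact WithLp.ofLp_injective 2 (Prod.ext hfst hsnd)
  -- Two coordinates, each with a domination factor 2, account for the 4.
  obtain ⟨F₁, hF₁, tight₁⟩ := h₁.tight (ε / 4) (by positivity)
  obtain ⟨F₂, hF₂, tight₂⟩ := h₂.tight (ε / 4) (by positivity)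
  refine ⟨(F₁.prod F₂).map (WithLp.linearEquiv 2 ℝ (H₁ × H₂)).symm.toLinearMap, ?_, ?_⟩
  · have : FiniteDimensional ℝ (F₁.prod F₂) := Module.Finite.iff_fg.2
      ((Module.Finite.iff_fg.1 hF₁).prod (Module.Finite.iff_fg.1 hF₂))
    infer_instance
  intro F _ hF
  have hmem (x : F₁) (y : F₂) : WithLp.toLp 2 ((x : H₁), (y : H₂)) ∈
      (F₁.prod F₂).map (WithLp.linearEquiv 2 ℝ (H₁ × H₂)).symm.toLinearMap :=
    Submodule.mem_map_of_mem (f := (WithLp.linearEquiv 2 ℝ (H₁ × H₂)).symm.toLinearMap)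
      (Submodule.mem_prod.2 ⟨x.2, y.2⟩ : ((x : H₁), (y : H₂)) ∈ F₁.prod F₂)
  have orth₁ : (F.map (WithLp.fstₗ 2 ℝ H₁ H₂)).IsOrtho F₁ := by
    rw [Submodule.isOrtho_iff_inner_eq]
    rintro _ ⟨h, hh, rfl⟩ g hg
    simpa using Submodule.isOrtho_iff_inner_eq.1 hF h hh _ (hmem ⟨g, hg⟩ 0)
  have orth₂ : (F.map (WithLp.sndₗ 2 ℝ H₁ H₂)).IsOrtho F₂ := by
    rw [Submodule.isOrtho_iff_inner_eq]
    rintro _ ⟨h, hh, rfl⟩ g hg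
    simpa using Submodule.isOrtho_iff_inner_eq.1 hF h hh _ (hmem 0 ⟨g, hg⟩)
  have hsubset : {h : F | ε < ‖directSumMap ι₁ ι₂ h‖} ⊆
      {h : F | ε / 4 < ‖ι₁ (h : WithLp 2 (H₁ × H₂)).fst‖} ∪
        {h : F | ε / 4 < ‖ι₂ (h : WithLp 2 (H₁ × H₂)).snd‖} := by
    intro h hh
    by_contra hcon
    simp only [Set.mem_union, Set.mem_ofPred_eq, not_or, not_lt, norm_directSumMap] at hcon hh
    linarith
  calc gammaMeasure F {h : F | ε < ‖directSumMap ι₁ ι₂ h‖}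
      ≤ gammaMeasure F {h : F | ε / 4 < ‖ι₁ (h : WithLp 2 (H₁ × H₂)).fst‖} +
          gammaMeasure F {h : F | ε / 4 < ‖ι₂ (h : WithLp 2 (H₁ × H₂)).snd‖} :=
        (measure_mono hsubset).trans (measure_union_le _ _)
    _ ≤ 2 * gammaMeasure (F.map (WithLp.fstₗ 2 ℝ H₁ H₂)) {h | ε / 4 < ‖ι₁ h‖} +
          2 * gammaMeasure (F.map (WithLp.sndₗ 2 ℝ H₁ H₂)) {h | ε / 4 < ‖ι₂ h‖} :=
        add_le_add (gammaMeasure_lt_norm_fst_le ι₁ F _) (gammaMeasure_lt_norm_snd_le ι₂ F _)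
    _ < 2 * ENNReal.ofReal (ε / 4) + 2 * ENNReal.ofReal (ε / 4) :=
        ENNReal.add_lt_add
          ((ENNReal.mul_lt_mul_iff_right (by simp) (by simp)).2 (tight₁ _ orth₁))
          ((ENNReal.mul_lt_mul_iff_right (by simp) (by simp)).2 (tight₂ _ orth₂))
    _ = ENNReal.ofReal ε := by
        rw [← ENNReal.ofReal_ofNat, ← ENNReal.ofReal_mul (by norm_num),
          ← ENNReal.ofReal_add (by positivity) (by positivity)]
        congr 1
        ring

variable [MeasurableSpace B₁] [MeasurableSpace B₂] {ι₁ : H₁ →ₗ[ℝ] B₁} {ι₂ : H₂ →ₗ[ℝ] B₂}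
  {μ₁ : Measure B₁} {μ₂ : Measure B₂}

theorem IsAbstractWienerSpace.separableSpace (h₁ : IsAbstractWienerSpace ι₁ μ₁) :
    TopologicalSpace.SeparableSpace B₁ :=
  have := h₁.separable_H
  h₁.dense.separableSpace h₁.measurable_norm.continuous

theorem IsAbstractWienerSpace.directSum (h₁ : IsAbstractWienerSpace ι₁ μ₁)
    (h₂ : IsAbstractWienerSpace ι₂ μ₂) :
    IsAbstractWienerSpace (directSumMap ι₁ ι₂) (directSumMeasure μ₁ μ₂) := by
  have := h₁.complete_H
  have := h₂.complete_H
  have := h₁.separable_H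
  have := h₂.separable_H
  have := h₁.complete_B
  have := h₂.complete_B
  have := h₁.borel_B
  have := h₂.borel_B
  have := h₁.prob
  have := h₂.prob
  have := h₁.separableSpace
  have := h₂.separableSpace
  -- Second countability identifies the product σ-algebra on `B₁ × B₂` with the Borel one.
  have : SecondCountableTopology B₁ := UniformSpace.secondCountable_of_separable B₁
  have : SecondCountableTopology B₂ := UniformSpace.secondCountable_of_separable B₂
  have hmeas : Measurable (WithLp.toLp 1 : B₁ × B₂ → WithLp 1 (B₁ × B₂)) :=
    WithLp.measurable_toLp 1 _
  exact
  { complete_H := inferInstance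
    separable_H := (WithLp.homeomorphProd 2 H₁ H₂).symm.surjective.denseRange.separableSpace
      (WithLp.homeomorphProd 2 H₁ H₂).symm.continuous
    measurable_norm := h₁.measurable_norm.directSum h₂.measurable_norm
    complete_B := inferInstance
    dense := by
      have h := ((WithLp.homeomorphProd 1 B₁ B₂).symm.surjective.denseRange.comp
        (h₁.dense.prodMap h₂.dense) (WithLp.homeomorphProd 1 B₁ B₂).symm.continuous)
      refine h.mono ?_
      rintro _ ⟨⟨x, y⟩, rfl⟩
      exact ⟨WithLp.toLp 2 (x, y), rfl⟩
    borel_B := inferInstance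
    prob := Measure.isProbabilityMeasure_map hmeas.aemeasurable
    gaussian f φ hφ := by
      let φ₁ : StrongDual ℝ B₁ := φ ∘L (WithLp.prodContinuousLinearEquiv 1 ℝ B₁ B₂).symm ∘L
        ContinuousLinearMap.inl ℝ B₁ B₂
      let φ₂ : StrongDual ℝ B₂ := φ ∘L (WithLp.prodContinuousLinearEquiv 1 ℝ B₁ B₂).symm ∘L
        ContinuousLinearMap.inr ℝ B₁ B₂
      have hsplit (p : B₁ × B₂) : φ (WithLp.toLp 1 p) = φ₁ p.1 + φ₂ p.2 := by
        simp only [φ₁, φ₂, ContinuousLinearMap.comp_apply, ← map_add]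
        simp
      have e₁ := h₁.gaussian f.fst φ₁ fun h ↦ by
        have := hφ (WithLp.toLp 2 (h, 0))
        simpa [directSumMap, hsplit] using this
      have e₂ := h₂.gaussian f.snd φ₂ fun h ↦ by
        have := hφ (WithLp.toLp 2 (0, h))
        simpa [directSumMap, hsplit] using this
      rw [directSumMeasure, integral_map hmeas.aemeasurable
        (Measurable.aestronglyMeasurable (by fun_prop))]
      simp_rw [hsplit, Complex.ofReal_add, mul_add, Complex.exp_add]
      rw [integral_prod_mul (fun x ↦ Complex.exp (Complex.I * (φ₁ x : ℂ)))
        (fun y ↦ Complex.exp (Complex.I * (φ₂ y : ℂ))), e₁, e₂, ← Complex.exp_add, ← mul_add]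
      congr 2
      exact_mod_cast (WithLp.prod_norm_sq_eq_of_L2 f).symm }

end DirectSum

theorem proposition3p3 {H₁ H₂ B₁ B₂ : Type*}
    [NormedAddCommGroup H₁] [InnerProductSpace ℝ H₁]
    [NormedAddCommGroup H₂] [InnerProductSpace ℝ H₂]
    [NormedAddCommGroup B₁] [NormedSpace ℝ B₁] [MeasurableSpace B₁]
    [NormedAddCommGroup B₂] [NormedSpace ℝ B₂] [MeasurableSpace B₂]
    (ι₁ : H₁ →ₗ[ℝ] B₁) (ι₂ : H₂ →ₗ[ℝ] B₂) (μ₁ : Measure B₁) (μ₂ : Measure B₂)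
    (h₁ : IsAbstractWienerSpace ι₁ μ₁) (h₂ : IsAbstractWienerSpace ι₂ μ₂)
    (hinf₁ : ¬ FiniteDimensional ℝ H₁) (hinf₂ : ¬ FiniteDimensional ℝ H₂) :
    (∀ (x₁ : B₁) (x₂ : B₂), ‖WithLp.toLp 1 (x₁, x₂)‖ = ‖x₁‖ + ‖x₂‖) ∧
    CompleteSpace (WithLp 1 (B₁ × B₂)) ∧
    TopologicalSpace.SeparableSpace (WithLp 1 (B₁ × B₂)) ∧
    IsAbstractWienerSpace (directSumMap ι₁ ι₂) (directSumMeasure μ₁ μ₂) ∧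
    IsCameronMartinSpace (directSumMap ι₁ ι₂) (directSumMeasure μ₁ μ₂) := by
  have h := h₁.directSum h₂
  exact ⟨fun x₁ x₂ ↦ WithLp.prod_norm_eq_of_L1 _, h.complete_B, h.separableSpace, h,
    h.isCameronMartinSpace⟩
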